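/- Let $f:[0,+\infty)\to(-\infty,0]$ be a smooth function with $f(0)=0$, $f'(t)<0$ for all $t\ge 0$ and $\lim_{t\to+\infty}f(t)=-\infty$. Let $M=\mathcal B_0(T^2)\cong\mathbb H^2\times\mathbb C^*$, with coordinates $z=x+iy$ ($y>0$) and $w=u+iv\neq 0$, carry the symplectic form $$\begin{aligned}\omega_f={}&\big(-1+f-3f'y^3(u^2+v^2)\big)\frac{dx\wedge dy}{y^2}-\frac43 f'y^3\,du\wedge dv\\&-2y^2f'\Big(u(dx\wedge du+dy\wedge dv)+v(du\wedge dy-dv\wedge dx)\Big),\end{aligned}$$ where $f,f'$ are evaluated at $y^3(u^2+v^2)$. Let $$H_1(z,w)=\tfrac23 f\big(y^3|w|^2\big),\qquad H_2(z,w)=2\,\tfrac{x}{y}\big(1-f(y^3|w|^2)\big),\qquad H=(H_1,H_2):M\to B:=H(M)\subset\mathbb R^2,$$ and let $\mathbb X_{H_i}$ be the Hamiltonian vector fields, $\omega_f(\mathbb X_{H_i},\cdot)=dH_i$. Then $B=\{(b_1,b_2)\in\mathbb R^2: b_1<0\}$, both $\mathbb X_{H_i}$ are complete on $M$, and $H$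 has a smooth global Lagrangian section. For every smooth global Lagrangian section $\sigma:B\to M$ of $H$ there exist angle coordinates with origin on $\sigma$: smooth functions $s:M\to\mathbb R$ and $\theta:M\to S^1=\mathbb R/2\pi\mathbb Z$ such that $(s,\theta)$ identifies every fibre $H^{-1}(b)$, $b\in B$, with $\mathbb R\times S^1$, the flow of $\mathbb X_{H_1}$ at time $t$ is $(s,\theta)\mapsto(s,\theta+t)$, the flow of $\mathbb X_{H_2}$ at time $t$ is $(s,\theta)\mapsto(s+t,\theta)$, and $s=\theta=0$ along $\sigma(B)$. For any such angle coordinates, $\{\theta,H_1,s,H_2\}$ is a global Darboux frame for $\omega_f$: the map $(\theta,H_1,s,H_2)$ is a diffeomorphism of $M$ onto $\{(\theta,b_1,s,b_2)\in S^1\times\mathbb R\times\mathbb R\times\mathbb R:(b_1,b_2)\in B\}$, and $$\omega_f=d\theta\wedge dH_1+ds\wedge dH_2 .$$ So the integrals of motion themselves serve as action coordinates. -/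

import Mathlib

open Set Filter Topology
open scoped Manifold ContDiff ComplexConjugate

noncomputable section

namespace ConvexTorus

/-- The ambient real vector space, with points `(z, w) = (x + i y, u + i v)`. -/
abbrev E : Type := ℂ × ℂ

/-- `ℍ² × ℂ*`, the parametrization of the deformation space of properly convex real projective
structures on the torus: an open subset of `ℂ × ℂ`. -/
def B0 : Set E := {p | 0 < p.1.im ∧ p.2 ≠ 0}

/-- The admissible functions `f : [0, ∞) → (-∞, 0]`: smooth, `f 0 = 0`, `f' < 0` on `[0, ∞)` and
`f t → -∞` as `t → ∞`.  The values of `f` on the negative half-line are never used. -/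
structure IsAdmissible (f : ℝ → ℝ) : Prop where
  smooth : ContDiffOn ℝ ∞ f (Ici 0)
  zero : f 0 = 0
  deriv_neg : ∀ t : ℝ, 0 ≤ t → derivWithin f (Ici 0) t < 0
  tendsto : Tendsto f atTop atBot

/-- The fibre norm squared `Im(z)³ |w|²`. -/
def fibreNormSq (p : E) : ℝ := p.1.im ^ 3 * ‖p.2‖ ^ 2

/-- The wedge product `a ∧ b` of two linear forms, evaluated on a pair of vectors. -/
def wedge (a b : E → ℝ) (v w : E) : ℝ := a v * b w - a w * b v

/-- The coordinate form `dx` on `ℂ × ℂ`. -/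
def dx (v : E) : ℝ := v.1.re
/-- The coordinate form `dy`. -/
def dy (v : E) : ℝ := v.1.im
/-- The coordinate form `du`. -/
def du (v : E) : ℝ := v.2.re
/-- The coordinate form `dv`. -/
def dv (v : E) : ℝ := v.2.im

/-- The symplectic form `ω_f` at the point `p = (x + i y, u + i v)`:
`(-1 + f - 3 f' y³ (u² + v²)) dx∧dy / y² - (4/3) f' y³ du∧dv
  - 2 y² f' (u (dx∧du + dy∧dv) + v (du∧dy - dv∧dx))`,
where `f` and `f'` are evaluated at `y³ (u² + v²)`. -/
def omega (f : ℝ → ℝ) (p : E) (a b : E) : ℝ :=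
  let y : ℝ := p.1.im
  let u : ℝ := p.2.re
  let v : ℝ := p.2.im
  let F : ℝ := f (y ^ 3 * (u ^ 2 + v ^ 2))
  let F' : ℝ := derivWithin f (Ici 0) (y ^ 3 * (u ^ 2 + v ^ 2))
  (-1 + F - 3 * F' * y ^ 3 * (u ^ 2 + v ^ 2)) * (wedge dx dy a b / y ^ 2)
    - 4 / 3 * F' * y ^ 3 * wedge du dv a b
    - 2 * y ^ 2 * F' *
      (u * (wedge dx du a b + wedge dy dv a b) + v * (wedge du dy a b - wedge dv dx a b))

/-- The first integral of motion, the Hamiltonian of the circle action. -/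
def H1 (f : ℝ → ℝ) (p : E) : ℝ := 2 / 3 * f (fibreNormSq p)

/-- The second integral of motion, the Hamiltonian of the action of the diagonal subgroup. -/
def H2 (f : ℝ → ℝ) (p : E) : ℝ := 2 * (p.1.re / p.1.im) * (1 - f (fibreNormSq p))

/-- The fibration `H = (H₁, H₂)`. -/
def H (f : ℝ → ℝ) (p : E) : ℝ × ℝ := (H1 f p, H2 f p)

/-- The base `B = H(ℍ² × ℂ*)` of the fibration. -/
def base (f : ℝ → ℝ) : Set (ℝ × ℝ) := H f '' B0

/-- The fibre of `H` over `b`. -/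
def fibre (f : ℝ → ℝ) (b : ℝ × ℝ) : Set E := {p | p ∈ B0 ∧ H f p = b}

/-- `γ : ℝ → ℍ² × ℂ*` is a (complete) integral curve of the Hamiltonian vector field `X_h`, which is
defined by `ω_f(X_h, ·) = dh`. -/
def IsHamiltonianTrajectory (f : ℝ → ℝ) (h : E → ℝ) (γ : ℝ → E) : Prop :=
  ∀ t : ℝ, γ t ∈ B0 ∧ DifferentiableAt ℝ γ t ∧
    ∀ v : E, omega f (γ t) (deriv γ t) v = fderiv ℝ h (γ t) v

/-- A smooth global Lagrangian section `σ : B → ℍ² × ℂ*` of `H`. -/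
structure IsLagrangianSection (f : ℝ → ℝ) (σ : ℝ × ℝ → E) : Prop where
  smooth : ContDiffOn ℝ ∞ σ (base f)
  mem : ∀ b ∈ base f, σ b ∈ B0
  section_eq : ∀ b ∈ base f, H f (σ b) = b
  lagrangian : ∀ b ∈ base f, ∀ v w : ℝ × ℝ,
    omega f (σ b) (fderiv ℝ σ b v) (fderiv ℝ σ b w) = 0

/-- `(s, θ)` are angle coordinates, with values in `ℝ × S¹`, of the integrable system
`(ℍ² × ℂ*, ω_f, H₁, H₂)`, with origin on the section `σ`: they are smooth, they
identify every fibre of `H` with `ℝ × S¹`, they linearize the flows of `X_{H₁}` and `X_{H₂}`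
(`X_{H₁} = ∂/∂θ` and `X_{H₂} = ∂/∂s`), and they vanish along `σ`.
The neutral element `1` of `Circle` is the angle `0`, and `Circle.exp t` is the angle `t`. -/
structure IsAngleCoordinates (f : ℝ → ℝ) (σ : ℝ × ℝ → E) (θ : E → Circle) (s : E → ℝ) :
    Prop where
  smooth_theta : ContMDiffOn 𝓘(ℝ, E) (𝓡 1) ∞ θ B0
  smooth_s : ContDiffOn ℝ ∞ s B0
  bijOn_fibre : ∀ b ∈ base f, BijOn (fun p => (s p, θ p)) (fibre f b) univ
  flow_H1 : ∀ γ : ℝ → E, IsHamiltonianTrajectory f (H1 f) γ →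
    ∀ t : ℝ, θ (γ t) = Circle.exp t * θ (γ 0) ∧ s (γ t) = s (γ 0)
  flow_H2 : ∀ γ : ℝ → E, IsHamiltonianTrajectory f (H2 f) γ →
    ∀ t : ℝ, θ (γ t) = θ (γ 0) ∧ s (γ t) = t + s (γ 0)
  theta_origin : ∀ b ∈ base f, θ (σ b) = 1
  s_origin : ∀ b ∈ base f, s (σ b) = 0

/-- The differential `dθ` of a circle-valued function: if `θ = exp(i φ)` locally, then
`conj θ * D θ = i dφ`, so this is `dφ`. -/
def angleDiff (θ : E → Circle) (p v : E) : ℝ :=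
  (conj (θ p : ℂ) * fderiv ℝ (fun q => (θ q : ℂ)) p v).im

/-- `{θ, H₁, s, H₂}` is a global Darboux frame for `ω_f`: the map `(θ, H₁, s, H₂)` is a
diffeomorphism of `ℍ² × ℂ*` onto the set of all `(θ, b₁, s, b₂)` in `S¹ × ℝ × ℝ × ℝ` with
`(b₁, b₂) ∈ B`, and `ω_f = dθ ∧ dH₁ + ds ∧ dH₂`. -/
structure IsGlobalDarbouxFrame (f : ℝ → ℝ) (θ : E → Circle) (s : E → ℝ) : Prop where
  diffeo : ∃ Φ : PartialEquiv E (Circle × (ℝ × ℝ × ℝ)),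
    Φ.source = B0 ∧
    Φ.target = {q | (q.2.1, q.2.2.2) ∈ base f} ∧
    (∀ p ∈ B0, Φ p = (θ p, H1 f p, s p, H2 f p)) ∧
    ContMDiffOn 𝓘(ℝ, E) ((𝓡 1).prod 𝓘(ℝ, ℝ × ℝ × ℝ)) ∞ Φ Φ.source ∧
    ContMDiffOn ((𝓡 1).prod 𝓘(ℝ, ℝ × ℝ × ℝ)) 𝓘(ℝ, E) ∞ Φ.symm Φ.target
  form : ∀ p ∈ B0, ∀ v w : E,
    omega f p v w =
      wedge (angleDiff θ p) (fderiv ℝ (H1 f) p) v w + wedge (fderiv ℝ s p) (fderiv ℝ (H2 f) p) v w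

end ConvexTorus

end

namespace ConvexTorus

/-! The two Hamiltonian fields are linear: `H1` generates (0, iw) and `H2` generates (2z, -3w).
Since `ω_f` is nondegenerate, every trajectory is an orbit of the explicit action `act` of ℝ × S¹.
This action preserves `H` and is free and transitive on each fibre: `H1` determines y³|w|² because
`f` is strictly decreasing, and then `H2` determines x/y because 1 - f > 0. A section therefore
fixes the angle coordinates uniquely; they are differences of log y / 2 and arg w between a point
and the section point of its fibre.

The form is handled by the identity `omega_eq_wedge`: ω_f = d(arg w) ∧ dH₁ + d(log y / 2) ∧ dH₂ +
3/(4(1 - f)) dH₁ ∧ dH₂. The last term is pulled back from the base. Pulling the identity back along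
σ ∘ H gives zero, as σ is Lagrangian, and changes neither dH₁, dH₂ nor f. Subtracting the two
cancels the last term and leaves dθ ∧ dH₁ + ds ∧ dH₂ (`omega_eq`).

The same identity suggests a Lagrangian section: take w > 0, so that arg w is constant, and y = 1 -
f, so that the remaining two terms cancel. -/

/-! ### The domain and the differentials of the integrals of motion. -/

lemma isOpen_B0 : IsOpen B0 :=
  (isOpen_lt continuous_const (Complex.continuous_im.comp continuous_fst)).inter
    (isOpen_ne_fun continuous_snd continuous_const)

lemma sq_add_sq_pos {w : ℂ} (hw : w ≠ 0) : 0 < w.re ^ 2 + w.im ^ 2 := by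
  have := Complex.normSq_pos.2 hw
  rw [Complex.normSq_apply] at this
  nlinarith

lemma fibreNormSq_eq (p : E) : fibreNormSq p = p.1.im ^ 3 * (p.2.re ^ 2 + p.2.im ^ 2) := by
  rw [fibreNormSq, ← Complex.normSq_eq_norm_sq, Complex.normSq_apply]
  ring

lemma fibreNormSq_pos {p : E} (hp : p ∈ B0) : 0 < fibreNormSq p := by
  have h1 : 0 < p.1.im := hp.1
  have h2 : 0 < ‖p.2‖ := norm_pos_iff.2 hp.2
  unfold fibreNormSq
  positivity

lemma contDiff_fibreNormSq : ContDiff ℝ ∞ fibreNormSq := by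
  have h1 : ContDiff ℝ ∞ (fun p : E => p.1.im) := Complex.imCLM.contDiff.comp contDiff_fst
  have h2 : ContDiff ℝ ∞ (fun p : E => p.2.re) := Complex.reCLM.contDiff.comp contDiff_snd
  have h3 : ContDiff ℝ ∞ (fun p : E => p.2.im) := Complex.imCLM.contDiff.comp contDiff_snd
  rw [funext fibreNormSq_eq]
  exact (h1.pow 3).mul ((h2.pow 2).add (h3.pow 2))

namespace IsAdmissible

lemma contDiffAt {f : ℝ → ℝ} (hf : IsAdmissible f) {t : ℝ} (ht : 0 < t) : ContDiffAt ℝ ∞ f t :=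
  (hf.smooth t ht.le).contDiffAt (Ici_mem_nhds ht)

lemma hasDerivAt {f : ℝ → ℝ} (hf : IsAdmissible f) {t : ℝ} (ht : 0 < t) : HasDerivAt f (derivWithin f (Ici 0) t) t := by
  rw [derivWithin_of_mem_nhds (Ici_mem_nhds ht)]
  exact ((hf.contDiffAt ht).differentiableAt (by simp)).hasDerivAt

lemma strictAntiOn {f : ℝ → ℝ} (hf : IsAdmissible f) : StrictAntiOn f (Ici 0) := by
  refine strictAntiOn_of_deriv_neg (convex_Ici 0) hf.smooth.continuousOn fun t ht => ?_
  rw [interior_Ici] at ht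
  rw [(hf.hasDerivAt ht).deriv]
  exact hf.deriv_neg t (le_of_lt ht)

lemma neg {f : ℝ → ℝ} (hf : IsAdmissible f) {t : ℝ} (ht : 0 < t) : f t < 0 := by
  simpa [hf.zero] using hf.strictAntiOn (self_mem_Ici) ht.le ht

lemma exists_pos_eq {f : ℝ → ℝ} (hf : IsAdmissible f) {c : ℝ} (hc : c < 0) : ∃ t, 0 < t ∧ f t = c := by
  obtain ⟨T, hT, hT0⟩ := ((hf.tendsto.eventually_lt_atBot c).and (eventually_gt_atTop 0)).exists
  obtain ⟨t, ht, rfl⟩ := intermediate_value_Icc' hT0.le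
    (hf.smooth.continuousOn.mono Icc_subset_Ici_self) ⟨hT.le, by rw [hf.zero]; exact hc.le⟩
  refine ⟨t, lt_of_le_of_ne ht.1 ?_, rfl⟩
  rintro rfl
  rw [hf.zero] at hc
  exact lt_irrefl _ hc

lemma contDiffOn_H1 {f : ℝ → ℝ} (hf : IsAdmissible f) : ContDiffOn ℝ ∞ (H1 f) B0 := fun p hp =>
  (contDiffAt_const.mul ((hf.contDiffAt (fibreNormSq_pos hp)).comp p
    contDiff_fibreNormSq.contDiffAt)).contDiffWithinAt

lemma contDiffOn_H2 {f : ℝ → ℝ} (hf : IsAdmissible f) : ContDiffOn ℝ ∞ (H2 f) B0 := fun p hp => by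
  have h1 : ContDiff ℝ ∞ (fun p : E => p.1.im) := Complex.imCLM.contDiff.comp contDiff_fst
  have h2 : ContDiff ℝ ∞ (fun p : E => p.1.re) := Complex.reCLM.contDiff.comp contDiff_fst
  exact ((contDiffAt_const.mul (h2.contDiffAt.div h1.contDiffAt (ne_of_gt hp.1))).mul
    (contDiffAt_const.sub ((hf.contDiffAt (fibreNormSq_pos hp)).comp p
    contDiff_fibreNormSq.contDiffAt))).contDiffWithinAt

lemma contDiffOn_H {f : ℝ → ℝ} (hf : IsAdmissible f) : ContDiffOn ℝ ∞ (H f) B0 := hf.contDiffOn_H1.prodMk hf.contDiffOn_H2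

lemma differentiableAt_H1 {f : ℝ → ℝ} (hf : IsAdmissible f) {p : E} (hp : p ∈ B0) : DifferentiableAt ℝ (H1 f) p :=
  (hf.contDiffOn_H1.contDiffAt (isOpen_B0.mem_nhds hp)).differentiableAt (by simp)

lemma differentiableAt_H2 {f : ℝ → ℝ} (hf : IsAdmissible f) {p : E} (hp : p ∈ B0) : DifferentiableAt ℝ (H2 f) p :=
  (hf.contDiffOn_H2.contDiffAt (isOpen_B0.mem_nhds hp)).differentiableAt (by simp)

lemma differentiableAt_H {f : ℝ → ℝ} (hf : IsAdmissible f) {p : E} (hp : p ∈ B0) : DifferentiableAt ℝ (H f) p :=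
  (hf.contDiffOn_H.contDiffAt (isOpen_B0.mem_nhds hp)).differentiableAt (by simp)

lemma hasFDerivAt_coord (p : E) :
    HasFDerivAt (fun p : E => p.1.re) (Complex.reCLM.comp (ContinuousLinearMap.fst ℝ ℂ ℂ)) p ∧
    HasFDerivAt (fun p : E => p.1.im) (Complex.imCLM.comp (ContinuousLinearMap.fst ℝ ℂ ℂ)) p ∧
    HasFDerivAt (fun p : E => p.2.re) (Complex.reCLM.comp (ContinuousLinearMap.snd ℝ ℂ ℂ)) p ∧
    HasFDerivAt (fun p : E => p.2.im) (Complex.imCLM.comp (ContinuousLinearMap.snd ℝ ℂ ℂ)) p :=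
  ⟨(Complex.reCLM.comp (ContinuousLinearMap.fst ℝ ℂ ℂ)).hasFDerivAt,
    (Complex.imCLM.comp (ContinuousLinearMap.fst ℝ ℂ ℂ)).hasFDerivAt,
    (Complex.reCLM.comp (ContinuousLinearMap.snd ℝ ℂ ℂ)).hasFDerivAt,
    (Complex.imCLM.comp (ContinuousLinearMap.snd ℝ ℂ ℂ)).hasFDerivAt⟩

lemma fderiv_fibreNormSq (p a : E) : fderiv ℝ fibreNormSq p a =
    3 * p.1.im ^ 2 * (p.2.re ^ 2 + p.2.im ^ 2) * a.1.im +
      2 * p.1.im ^ 3 * (p.2.re * a.2.re + p.2.im * a.2.im) := by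
  obtain ⟨-, hy, hu, hv⟩ := hasFDerivAt_coord p
  have h := ((hasDerivAt_pow 3 _).comp_hasFDerivAt p hy).mul
    (((hasDerivAt_pow 2 _).comp_hasFDerivAt p hu).add ((hasDerivAt_pow 2 _).comp_hasFDerivAt p hv))
  rw [(h.congr_of_eventuallyEq (Eventually.of_forall fibreNormSq_eq)).fderiv]
  simp
  ring

lemma hasFDerivAt_comp_fibreNormSq {f : ℝ → ℝ} (hf : IsAdmissible f) {p : E} (hp : p ∈ B0) :
    HasFDerivAt (fun q => f (fibreNormSq q))
      (derivWithin f (Ici 0) (fibreNormSq p) • fderiv ℝ fibreNormSq p) p :=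
  (hf.hasDerivAt (fibreNormSq_pos hp)).comp_hasFDerivAt p
    (contDiff_fibreNormSq.differentiable (by simp) p).hasFDerivAt

lemma fderiv_H1 {f : ℝ → ℝ} (hf : IsAdmissible f) {p : E} (hp : p ∈ B0) (a : E) : fderiv ℝ (H1 f) p a =
    2 / 3 * (derivWithin f (Ici 0) (fibreNormSq p) *
    (3 * p.1.im ^ 2 * (p.2.re ^ 2 + p.2.im ^ 2) * a.1.im +
      2 * p.1.im ^ 3 * (p.2.re * a.2.re + p.2.im * a.2.im))) := by
  have h : HasFDerivAt (H1 f) _ p := (hf.hasFDerivAt_comp_fibreNormSq hp).const_mul (2 / 3)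
  rw [h.fderiv]
  simp [fderiv_fibreNormSq]

lemma fderiv_H2 {f : ℝ → ℝ} (hf : IsAdmissible f) {p : E} (hp : p ∈ B0) (a : E) : fderiv ℝ (H2 f) p a =
    2 * ((a.1.re * p.1.im - p.1.re * a.1.im) / p.1.im ^ 2) * (1 - f (fibreNormSq p)) -
    2 * (p.1.re / p.1.im) * (derivWithin f (Ici 0) (fibreNormSq p) *
    (3 * p.1.im ^ 2 * (p.2.re ^ 2 + p.2.im ^ 2) * a.1.im +
      2 * p.1.im ^ 3 * (p.2.re * a.2.re + p.2.im * a.2.im))) := by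
  obtain ⟨hx, hy, -, -⟩ := hasFDerivAt_coord p
  have hy0 : p.1.im ≠ 0 := ne_of_gt hp.1
  have h : HasFDerivAt (H2 f) _ p :=
    ((hx.mul ((hasDerivAt_inv hy0).comp_hasFDerivAt p hy)).const_mul 2).mul ((hf.hasFDerivAt_comp_fibreNormSq hp).const_sub 1)
  rw [h.fderiv]
  simp [fderiv_fibreNormSq]
  field_simp
  ring

lemma fderiv_H {f : ℝ → ℝ} (hf : IsAdmissible f) {p : E} (hp : p ∈ B0) (a : E) :
    fderiv ℝ (H f) p a = (fderiv ℝ (H1 f) p a, fderiv ℝ (H2 f) p a) := by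
  have h : HasFDerivAt (H f) _ p :=
    (hf.differentiableAt_H1 hp).hasFDerivAt.prodMk (hf.differentiableAt_H2 hp).hasFDerivAt
  rw [h.fderiv]
  rfl

end IsAdmissible

/-! ### The symplectic form: decomposition, nondegeneracy, Hamiltonian fields. -/

/-- The differential of `arg w` for the coordinate `w` on `ℂ*`. -/
noncomputable def dArg (p a : E) : ℝ := (a.2 / p.2).im

/-- The differential of `log y / 2`. -/
noncomputable def dHalfLog (p a : E) : ℝ := a.1.im / (2 * p.1.im)

lemma dArg_eq (p a : E) :
    dArg p a = (p.2.re * a.2.im - p.2.im * a.2.re) / (p.2.re ^ 2 + p.2.im ^ 2) := by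
  rw [dArg, Complex.div_im, Complex.normSq_apply]
  ring

/-- The first two terms are the Darboux shape sought; the coefficient of the third depends only on
`H1`, so that term comes from the base and can be removed by comparison with a Lagrangian section.
-/
lemma omega_eq_wedge {f : ℝ → ℝ} (hf : IsAdmissible f) {p : E} (hp : p ∈ B0) (a b : E) :
    omega f p a b = wedge (dArg p) (fderiv ℝ (H1 f) p) a b +
      wedge (dHalfLog p) (fderiv ℝ (H2 f) p) a b +
      3 / (4 * (1 - f (fibreNormSq p))) *
        wedge (fderiv ℝ (H1 f) p) (fderiv ℝ (H2 f) p) a b := by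
  have hy : p.1.im ≠ 0 := ne_of_gt hp.1
  have hw : p.2.re ^ 2 + p.2.im ^ 2 ≠ 0 := (sq_add_sq_pos hp.2).ne'
  have hF : 1 - f (fibreNormSq p) ≠ 0 := by
    have := hf.neg (fibreNormSq_pos hp)
    linarith
  simp only [omega, wedge, dx, dy, du, dv, hf.fderiv_H1 hp, hf.fderiv_H2 hp, dArg_eq, dHalfLog,
    ← fibreNormSq_eq]
  generalize f (fibreNormSq p) = F at *
  generalize derivWithin f (Ici 0) (fibreNormSq p) = F'
  generalize p.1.im = y at *
  generalize p.1.re = x at *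
  generalize p.2.re = u at *
  generalize p.2.im = v at *
  field_simp
  ring

lemma omega_sub_left (f : ℝ → ℝ) (p a a' b : E) :
    omega f p (a - a') b = omega f p a b - omega f p a' b := by
  simp only [omega, wedge, dx, dy, du, dv, Prod.fst_sub, Prod.snd_sub, Complex.sub_re,
    Complex.sub_im]
  ring

/-- Pairing with the u and v directions expresses `a.2` through `a.1`, because f' and y do not
vanish. Substituting into the pairings with the x and y directions leaves (f - 1) times each
component of `a.1`, and f - 1 < 0. -/
lemma eq_zero_of_omega_eq_zero {f : ℝ → ℝ} (hf : IsAdmissible f) {p : E} (hp : p ∈ B0) {a : E}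
    (h : ∀ b, omega f p a b = 0) : a = 0 := by
  have hy : 0 < p.1.im := hp.1
  have hw : 0 < p.2.re ^ 2 + p.2.im ^ 2 := sq_add_sq_pos hp.2
  have hF := hf.neg (fibreNormSq_pos hp)
  have hF' := hf.deriv_neg _ (fibreNormSq_pos hp).le
  have hx := h (1, 0)
  have hy' := h (Complex.I, 0)
  have hu := h (0, 1)
  have hv := h (0, Complex.I)
  simp only [omega, wedge, dx, dy, du, dv, ← fibreNormSq_eq] at hx hy' hu hv
  simp at hx hy' hu hv
  rw [Prod.ext_iff, Complex.ext_iff, Complex.ext_iff]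
  simp only [Prod.fst_zero, Prod.snd_zero, Complex.zero_re, Complex.zero_im]
  generalize f (fibreNormSq p) = F at *
  generalize derivWithin f (Ici 0) (fibreNormSq p) = F' at *
  generalize p.1.im = y at *
  generalize p.1.re = x at *
  generalize p.2.re = u at *
  generalize p.2.im = v at *
  have hu' : 2 * y * a.2.im = 3 * (u * a.1.re - v * a.1.im) := by
    refine mul_left_cancel₀ (mul_ne_zero hF'.ne (pow_ne_zero 2 hy.ne')) ?_
    linear_combination 3 / 2 * hu
  have hv' : 2 * y * a.2.re = -3 * (u * a.1.im + v * a.1.re) := by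
    refine mul_left_cancel₀ (mul_ne_zero hF'.ne (pow_ne_zero 2 hy.ne')) ?_
    linear_combination -3 / 2 * hv
  field_simp at hx hy'
  have hx0 : a.1.re = 0 := by
    refine (mul_eq_zero.1 (?_ : (-1 + F) * a.1.re = 0)).resolve_left (by linarith)
    linear_combination hy' - y ^ 3 * F' * u * hu' + y ^ 3 * F' * v * hv'
  have hy0 : a.1.im = 0 := by
    refine (mul_eq_zero.1 (?_ : (-1 + F) * a.1.im = 0)).resolve_left (by linarith)
    linear_combination -hx + y ^ 3 * F' * u * hv' + y ^ 3 * F' * v * hu'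
  simp only [hx0, hy0, mul_zero, sub_zero, add_zero, mul_eq_zero, OfNat.ofNat_ne_zero, hy.ne',
    false_or] at hu' hv'
  exact ⟨⟨hx0, hy0⟩, hv', hu'⟩

lemma omega_X1 {f : ℝ → ℝ} (hf : IsAdmissible f) {p : E} (hp : p ∈ B0) (b : E) :
    omega f p (0, Complex.I * p.2) b = fderiv ℝ (H1 f) p b := by
  have hy : p.1.im ≠ 0 := ne_of_gt hp.1
  simp only [omega, wedge, dx, dy, du, dv, hf.fderiv_H1 hp, ← fibreNormSq_eq]
  simp
  ring

lemma omega_X2 {f : ℝ → ℝ} (hf : IsAdmissible f) {p : E} (hp : p ∈ B0) (b : E) :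
    omega f p (2 * p.1, -3 * p.2) b = fderiv ℝ (H2 f) p b := by
  have hy : p.1.im ≠ 0 := ne_of_gt hp.1
  simp only [omega, wedge, dx, dy, du, dv, hf.fderiv_H2 hp, ← fibreNormSq_eq]
  simp
  field_simp
  ring

/-! ### The circle-valued argument. -/

lemma coe_circleExp_arg_mul_norm (z : ℂ) : (Circle.exp z.arg : ℂ) * ‖z‖ = z := by
  rw [Circle.coe_exp, mul_comm, Complex.norm_mul_exp_arg_mul_I]

lemma circleExp_arg_ofReal_mul {r : ℝ} (hr : 0 < r) (c : Circle) :
    Circle.exp (Complex.arg (r * c)) = c := by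
  rw [Complex.arg_real_mul _ hr, Circle.exp_arg]

lemma circleExp_arg_eq_mul {z w : ℂ} (hz : z ≠ 0) (hw : w ≠ 0) :
    Circle.exp z.arg = Circle.exp (z / w).arg * Circle.exp w.arg := by
  have h1 := coe_circleExp_arg_mul_norm z
  have h2 := coe_circleExp_arg_mul_norm w
  have h3 := coe_circleExp_arg_mul_norm (z / w)
  have hz' : (‖z‖ : ℂ) ≠ 0 := by simpa using hz
  have hw' : (‖w‖ : ℂ) ≠ 0 := by simpa using hw
  refine Circle.ext (mul_right_cancel₀ hz' ?_)
  rw [h1, Circle.coe_mul]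
  rw [norm_div, Complex.ofReal_div] at h3
  field_simp at h3
  refine mul_left_cancel₀ hw ?_
  linear_combination -(Circle.exp w.arg : ℂ) * h3 - z * h2

/-- The real argument jumps across the cut, but its class in the circle is multiplicative. Dividing
by the value at `p` moves the base point to 1, where the logarithm is smooth. -/
lemma contMDiffOn_circleExp_arg {V : Type*} [NormedAddCommGroup V] [NormedSpace ℝ V] {U : Set V}
    (hU : IsOpen U) {g : V → ℂ} (hg : ContDiffOn ℝ ∞ g U) (hg0 : ∀ p ∈ U, g p ≠ 0) :
    ContMDiffOn 𝓘(ℝ, V) (𝓡 1) ∞ (fun p => Circle.exp (g p).arg) U := by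
  intro p hp
  have hgp := hg.contDiffAt (hU.mem_nhds hp)
  have h1 : ContDiffAt ℝ ∞ (fun q => (Complex.log (g q / g p)).im) p := by
    have h2 : ContDiffAt ℝ ∞ Complex.log (g p / g p) := by
      refine (Complex.contDiffAt_log ?_).restrict_scalars ℝ
      rw [div_self (hg0 p hp)]
      exact Complex.one_mem_slitPlane
    have h3 : ContDiffAt ℝ ∞ (fun q => g q / g p) p := hgp.div_const _
    exact Complex.imCLM.contDiff.contDiffAt.comp p
      (ContDiffAt.comp (f := fun q => g q / g p) p h2 h3)
  have h4 : ContMDiffAt 𝓘(ℝ, V) (𝓡 1) ∞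
      (fun q => Circle.exp (Complex.log (g q / g p)).im * Circle.exp (g p).arg) p :=
    (contMDiff_circleExp.contMDiffAt.comp p h1.contMDiffAt).mul contMDiffAt_const
  refine (h4.congr_of_eventuallyEq ?_).contMDiffWithinAt
  filter_upwards [hU.mem_nhds hp] with q hq
  rw [Complex.log_im, ← circleExp_arg_eq_mul (hg0 q hq) (hg0 p hp)]

/-- The same normalisation at `p` gives dθ = iθ Im(dg/g), the form in which `angleDiff` reads off
the angle. -/
lemma fderiv_coe_circleExp_arg {V : Type*} [NormedAddCommGroup V] [NormedSpace ℝ V] {g : V → ℂ}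
    {g' : V →L[ℝ] ℂ} {p : V} (hg : HasFDerivAt g g' p) (hp : g p ≠ 0) (v : V) :
    fderiv ℝ (fun q => (Circle.exp (g q).arg : ℂ)) p v =
      Circle.exp (g p).arg * ((g' v / g p).im * Complex.I) := by
  have h1 : HasFDerivAt (fun q => Complex.log (g q / g p)) ((g p)⁻¹ • g') p := by
    have h3 : HasFDerivAt (fun q => g q / g p) ((g p)⁻¹ • g') p := by
      simpa only [div_eq_mul_inv, mul_comm] using hg.const_mul ((g p)⁻¹)
    have h2 : HasFDerivAt Complex.log
        ((ContinuousLinearMap.toSpanSingleton ℂ (1 : ℂ)).restrictScalars ℝ) (g p / g p) := by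
      have := (Complex.hasDerivAt_log (z := g p / g p)
        (by rw [div_self hp]; exact Complex.one_mem_slitPlane)).hasFDerivAt.restrictScalars ℝ
      simpa [div_self hp] using this
    refine (h2.comp p h3).congr_fderiv ?_
    ext v
    simp
  have h5 := (((Complex.ofRealCLM.hasFDerivAt.comp p (Complex.imCLM.hasFDerivAt.comp p h1)).mul_const Complex.I).cexp.mul_const
    (Circle.exp (g p).arg : ℂ))
  have h6 : (fun q => (Circle.exp (g q).arg : ℂ)) =ᶠ[𝓝 p]
    fun q => Complex.exp ((Complex.log (g q / g p)).im * Complex.I) *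
      (Circle.exp (g p).arg : ℂ) := by
    filter_upwards [hg.continuousAt.eventually_ne hp] with q hq
    rw [circleExp_arg_eq_mul hq hp]
    simp [Complex.log_im]
  rw [(h5.congr_of_eventuallyEq h6).fderiv]
  simp [div_self hp, Complex.div_im]
  ring

/-! ### The action of ℝ × S¹ and its orbits. -/

/-- The action of `ℝ × S¹` on `ℍ² × ℂ*` generated by the two Hamiltonian flows. -/
noncomputable def act (t : ℝ) (c : Circle) (p : E) : E :=
  ((Real.exp (2 * t) : ℂ) * p.1, (Real.exp (-3 * t) : ℂ) * c * p.2)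

lemma act_fst_im (t : ℝ) (c : Circle) (p : E) : (act t c p).1.im = Real.exp (2 * t) * p.1.im := by
  simp [act, -Complex.ofReal_exp]

lemma act_fst_re (t : ℝ) (c : Circle) (p : E) : (act t c p).1.re = Real.exp (2 * t) * p.1.re := by
  simp [act, -Complex.ofReal_exp]

lemma norm_act_snd (t : ℝ) (c : Circle) (p : E) :
    ‖(act t c p).2‖ = Real.exp (-3 * t) * ‖p.2‖ := by
  rw [act, norm_mul, norm_mul, Circle.norm_coe, Complex.norm_real, Real.norm_eq_abs, Real.abs_exp,
    mul_one]

lemma act_mem {p : E} (hp : p ∈ B0) (t : ℝ) (c : Circle) : act t c p ∈ B0 := by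
  refine ⟨?_, ?_⟩
  · rw [act_fst_im]
    exact mul_pos (Real.exp_pos _) hp.1
  · rw [← norm_pos_iff, norm_act_snd]
    exact mul_pos (Real.exp_pos _) (norm_pos_iff.2 hp.2)

/-- The weights 2 and -3 balance in y³|w|²: exp(2t)³ · exp(-3t)² = 1. -/
lemma fibreNormSq_act (t : ℝ) (c : Circle) (p : E) : fibreNormSq (act t c p) = fibreNormSq p := by
  rw [fibreNormSq, fibreNormSq, act_fst_im, norm_act_snd, mul_pow, mul_pow, ← Real.exp_nat_mul,
    ← Real.exp_nat_mul, mul_mul_mul_comm, ← Real.exp_add]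
  ring_nf
  simp

lemma H_act (f : ℝ → ℝ) (t : ℝ) (c : Circle) (p : E) : H f (act t c p) = H f p := by
  rw [H, H, H1, H1, H2, H2, fibreNormSq_act, act_fst_re, act_fst_im,
    mul_div_mul_left _ _ (Real.exp_pos _).ne']

lemma act_zero_one (p : E) : act 0 1 p = p := by simp [act]

lemma act_zero_act (c : Circle) (t : ℝ) (p : E) : act 0 c (act t 1 p) = act t c p := by
  simp [act]
  ring

/-- The orbits of the action are the fibres of `H`. -/
lemma act_eq_of_H_eq {f : ℝ → ℝ} (hf : IsAdmissible f) {p q : E} (hp : p ∈ B0) (hq : q ∈ B0)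
    (h : H f p = H f q) :
    act ((Real.log p.1.im - Real.log q.1.im) / 2) (Circle.exp (p.2 / q.2).arg) q = p := by
  have hyp : 0 < p.1.im := hp.1
  have hyq : 0 < q.1.im := hq.1
  have hwq : 0 < ‖q.2‖ := norm_pos_iff.2 hq.2
  obtain ⟨h1, h2⟩ := Prod.ext_iff.1 h
  simp only [H, H1, H2] at h1 h2
  have hN : fibreNormSq p = fibreNormSq q :=
    hf.strictAntiOn.injOn (fibreNormSq_pos hp).le (fibreNormSq_pos hq).le (by linarith)
  have hF : 1 - f (fibreNormSq q) ≠ 0 := by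
    have := hf.neg (fibreNormSq_pos hq)
    linarith
  rw [hN] at h2
  have hx := mul_left_cancel₀ two_ne_zero (mul_right_cancel₀ hF h2)
  set t := (Real.log p.1.im - Real.log q.1.im) / 2 with ht
  have he : Real.exp (2 * t) = p.1.im / q.1.im := by
    rw [ht, mul_div_cancel₀ _ two_ne_zero, Real.exp_sub, Real.exp_log hyp, Real.exp_log hyq]
  have he3 : Real.exp (-3 * t) * ‖q.2‖ = ‖p.2‖ := by
    -- `t` was chosen to match the imaginary parts; invariance of y³|w|² then forces the moduli of
    -- the second coordinates to match.
    have hn := fibreNormSq_act t 1 q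
    rw [fibreNormSq, act_fst_im, norm_act_snd, he, div_mul_cancel₀ _ hyq.ne', ← hN, fibreNormSq] at hn
    have := mul_left_cancel₀ (pow_ne_zero 3 hyp.ne') hn
    exact (pow_left_inj₀ (by positivity) (by positivity) two_ne_zero).1 this
  refine Prod.ext (Complex.ext ?_ ?_) ?_
  · rw [act_fst_re, he]
    rw [div_eq_div_iff hyp.ne' hyq.ne'] at hx
    rw [div_mul_eq_mul_div, div_eq_iff hyq.ne']
    linarith
  · rw [act_fst_im, he, div_mul_cancel₀ _ hyq.ne']
  · have hc := coe_circleExp_arg_mul_norm (p.2 / q.2)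
    rw [norm_div, ← he3, mul_div_cancel_right₀ _ hwq.ne'] at hc
    rw [act, mul_comm (Real.exp (-3 * t) : ℂ), hc, div_mul_cancel₀ _ hq.2]

/-! ### Hamiltonian trajectories. -/

lemma eq_exp_mul_of_hasDerivAt {g : ℝ → ℂ} {k : ℂ} (h : ∀ t, HasDerivAt g (k * g t) t) (t : ℝ) :
    g t = Complex.exp (k * t) * g 0 := by
  have h1 : ∀ t : ℝ, HasDerivAt (fun t : ℝ => Complex.exp (-(k * t)) * g t) 0 t := fun t => by
    have h2 : HasDerivAt (fun t : ℝ => -(k * (t : ℂ))) (-(k * 1)) t :=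
      ((hasDerivAt_id t).ofReal_comp.const_mul k).neg
    refine (h2.cexp.fun_mul (h t)).congr_deriv ?_
    ring
  have h3 := is_const_of_deriv_eq_zero (fun t => (h1 t).differentiableAt) (fun t => (h1 t).deriv) t 0
  simp only [Complex.ofReal_zero, mul_zero, neg_zero, Complex.exp_zero, one_mul] at h3
  rw [← h3, ← mul_assoc, ← Complex.exp_add, add_neg_cancel, Complex.exp_zero, one_mul]

lemma hasDerivAt_exp_mul (k : ℂ) (z : ℂ) (t : ℝ) :
    HasDerivAt (fun t : ℝ => Complex.exp (k * t) * z) (k * (Complex.exp (k * t) * z)) t := by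
  have h2 : HasDerivAt (fun t : ℝ => k * (t : ℂ)) (k * 1) t :=
    (hasDerivAt_id t).ofReal_comp.const_mul k
  refine (h2.cexp.mul_const z).congr_deriv ?_
  ring

lemma isHamiltonianTrajectory_H1 {f : ℝ → ℝ} (hf : IsAdmissible f) {p : E} (hp : p ∈ B0) :
    IsHamiltonianTrajectory f (H1 f) (fun t => act 0 (Circle.exp t) p) := by
  intro t
  have h : HasDerivAt (fun t : ℝ => act 0 (Circle.exp t) p)
      (0, Complex.I * (act 0 (Circle.exp t) p).2) t := by
    have := (hasDerivAt_const t p.1).prodMk (hasDerivAt_exp_mul Complex.I p.2 t)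
    simpa [act, mul_comm Complex.I] using this
  refine ⟨act_mem hp _ _, h.differentiableAt, fun v => ?_⟩
  rw [h.deriv, omega_X1 hf (act_mem hp _ _)]

lemma isHamiltonianTrajectory_H2 {f : ℝ → ℝ} (hf : IsAdmissible f) {p : E} (hp : p ∈ B0) :
    IsHamiltonianTrajectory f (H2 f) (fun t => act t 1 p) := by
  intro t
  have h : HasDerivAt (fun t : ℝ => act t 1 p) (2 * (act t 1 p).1, -3 * (act t 1 p).2) t := by
    have := (hasDerivAt_exp_mul 2 p.1 t).prodMk (hasDerivAt_exp_mul (-3) p.2 t)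
    simpa [act] using this
  refine ⟨act_mem hp _ _, h.differentiableAt, fun v => ?_⟩
  rw [h.deriv, omega_X2 hf (act_mem hp _ _)]

/-- Nondegeneracy lets the implicit condition defining a trajectory be solved for the velocity,
turning it into an ordinary differential equation. -/
lemma IsHamiltonianTrajectory.hasDerivAt {f : ℝ → ℝ} (hf : IsAdmissible f) {h : E → ℝ} {γ : ℝ → E}
    (hγ : IsHamiltonianTrajectory f h γ) {t : ℝ} {X : E}
    (hX : ∀ v, omega f (γ t) X v = fderiv ℝ h (γ t) v) : HasDerivAt γ X t := by
  obtain ⟨h1, h2, h3⟩ := hγ t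
  have : deriv γ t - X = 0 :=
    eq_zero_of_omega_eq_zero hf h1 fun v => by rw [omega_sub_left, h3, hX, sub_self]
  rw [← sub_eq_zero.1 this]
  exact h2.hasDerivAt

lemma IsHamiltonianTrajectory.eq_act_H1 {f : ℝ → ℝ} (hf : IsAdmissible f) {γ : ℝ → E}
    (hγ : IsHamiltonianTrajectory f (H1 f) γ) (t : ℝ) : γ t = act 0 (Circle.exp t) (γ 0) := by
  have h : ∀ t, HasDerivAt γ (0, Complex.I * (γ t).2) t := fun t =>
    IsHamiltonianTrajectory.hasDerivAt hf hγ (omega_X1 hf (hγ t).1)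
  have h1 := eq_exp_mul_of_hasDerivAt (g := fun t => (γ t).1) (k := 0)
    (fun t => by simpa using! (ContinuousLinearMap.fst ℝ ℂ ℂ).hasFDerivAt.comp_hasDerivAt t (h t)) t
  have h2 := eq_exp_mul_of_hasDerivAt (g := fun t => (γ t).2) (k := Complex.I)
    (fun t => by simpa using! (ContinuousLinearMap.snd ℝ ℂ ℂ).hasFDerivAt.comp_hasDerivAt t (h t)) t
  refine Prod.ext ?_ ?_
  · simpa [act] using h1
  · simpa [act, mul_comm Complex.I] using h2

lemma IsHamiltonianTrajectory.eq_act_H2 {f : ℝ → ℝ} (hf : IsAdmissible f) {γ : ℝ → E}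
    (hγ : IsHamiltonianTrajectory f (H2 f) γ) (t : ℝ) : γ t = act t 1 (γ 0) := by
  have h : ∀ t, HasDerivAt γ (2 * (γ t).1, -3 * (γ t).2) t := fun t =>
    IsHamiltonianTrajectory.hasDerivAt hf hγ (omega_X2 hf (hγ t).1)
  have h1 := eq_exp_mul_of_hasDerivAt (g := fun t => (γ t).1) (k := 2)
    (fun t => by simpa using! (ContinuousLinearMap.fst ℝ ℂ ℂ).hasFDerivAt.comp_hasDerivAt t (h t)) t
  have h2 := eq_exp_mul_of_hasDerivAt (g := fun t => (γ t).2) (k := -3)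
    (fun t => by simpa using! (ContinuousLinearMap.snd ℝ ℂ ℂ).hasFDerivAt.comp_hasDerivAt t (h t)) t
  refine Prod.ext ?_ ?_
  · simpa [act] using h1
  · simpa [act] using h2

/-! ### The base and an explicit point in each fibre. -/

/-- Any y > 0 would serve to hit `b`; the choice y = 1 - f is the one that makes the resulting
section Lagrangian. -/
lemma H_mk {f : ℝ → ℝ} {b : ℝ × ℝ} {N : ℝ} (hb : b.1 < 0) (hN : 0 < N) (hfN : f N = 3 / 2 * b.1) :
    H f (⟨b.2 / 2, 1 - 3 / 2 * b.1⟩, (√(N / (1 - 3 / 2 * b.1) ^ 3) : ℝ)) = b := by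
  have hy : 0 < 1 - 3 / 2 * b.1 := by linarith
  have h : fibreNormSq (⟨b.2 / 2, 1 - 3 / 2 * b.1⟩, (√(N / (1 - 3 / 2 * b.1) ^ 3) : ℝ)) = N := by
    rw [fibreNormSq, Complex.norm_real, Real.norm_eq_abs, sq_abs, Real.sq_sqrt (by positivity)]
    rw [mul_div_cancel₀ _ (pow_ne_zero 3 hy.ne')]
  refine Prod.ext ?_ ?_
  · simp only [H, H1, h, hfN]
    ring
  · simp only [H, H2, h, hfN]
    rw [mul_assoc, div_mul_cancel₀ _ hy.ne', mul_div_cancel₀ _ two_ne_zero]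

lemma mk_mem_B0 {b : ℝ × ℝ} {N : ℝ} (hb : b.1 < 0) (hN : 0 < N) :
    ((⟨b.2 / 2, 1 - 3 / 2 * b.1⟩, (√(N / (1 - 3 / 2 * b.1) ^ 3) : ℝ)) : E) ∈ B0 := by
  have hy : 0 < 1 - 3 / 2 * b.1 := by linarith
  refine ⟨hy, ?_⟩
  rw [ne_eq, Complex.ofReal_eq_zero]
  positivity

lemma base_eq {f : ℝ → ℝ} (hf : IsAdmissible f) : base f = {b : ℝ × ℝ | b.1 < 0} := by
  ext b
  refine ⟨?_, fun hb => ?_⟩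
  · rintro ⟨p, hp, rfl⟩
    have := hf.neg (fibreNormSq_pos hp)
    simp only [H, H1, mem_ofPred_eq]
    linarith
  · have hb' : b.1 < 0 := hb
    obtain ⟨N, hN, hfN⟩ := hf.exists_pos_eq (c := 3 / 2 * b.1) (by linarith)
    exact ⟨_, mk_mem_B0 hb' hN, H_mk hb' hN hfN⟩

lemma isOpen_base {f : ℝ → ℝ} (hf : IsAdmissible f) : IsOpen (base f) := by
  rw [base_eq hf]
  exact isOpen_lt continuous_fst continuous_const

lemma H_mem_base {f : ℝ → ℝ} {p : E} (hp : p ∈ B0) : H f p ∈ base f := mem_image_of_mem _ hp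

/-! ### Angle coordinates measured from a section. -/

/-- The translation coordinate on `ℍ² × ℂ*` measured from the section `σ`. -/
noncomputable def sCoord (f : ℝ → ℝ) (σ : ℝ × ℝ → E) (p : E) : ℝ :=
  (Real.log p.1.im - Real.log (σ (H f p)).1.im) / 2

/-- The angle coordinate on `ℍ² × ℂ*` measured from the section `σ`. -/
noncomputable def thetaCoord (f : ℝ → ℝ) (σ : ℝ × ℝ → E) (p : E) : Circle :=
  Circle.exp (p.2 / (σ (H f p)).2).arg

lemma fderiv_H_section {f : ℝ → ℝ} (hf : IsAdmissible f) {σ : ℝ × ℝ → E} {b : ℝ × ℝ}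
    (hb : b ∈ base f) (hσ : DifferentiableAt ℝ σ b) (hmem : σ b ∈ B0)
    (hsec : ∀ b ∈ base f, H f (σ b) = b) (v : ℝ × ℝ) :
    fderiv ℝ (H f) (σ b) (fderiv ℝ σ b v) = v := by
  have h1 := (hf.differentiableAt_H hmem).hasFDerivAt.comp b hσ.hasFDerivAt
  have h2 : HasFDerivAt (H f ∘ σ) (ContinuousLinearMap.id ℝ (ℝ × ℝ)) b := by
    refine (hasFDerivAt_id b).congr_of_eventuallyEq ?_
    filter_upwards [(isOpen_base hf).mem_nhds hb] with b' hb'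
    exact hsec b' hb'
  have h3 := h1.unique h2
  exact DFunLike.congr_fun h3 v

namespace IsLagrangianSection

lemma contDiffOn_comp_H {f : ℝ → ℝ} (hf : IsAdmissible f) {σ : ℝ × ℝ → E}
    (hσ : IsLagrangianSection f σ) : ContDiffOn ℝ ∞ (fun p => σ (H f p)) B0 :=
  hσ.smooth.comp hf.contDiffOn_H fun _ hp => H_mem_base hp

lemma differentiableAt {f : ℝ → ℝ} (hf : IsAdmissible f) {σ : ℝ × ℝ → E}
    (hσ : IsLagrangianSection f σ) {b : ℝ × ℝ} (hb : b ∈ base f) : DifferentiableAt ℝ σ b :=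
  (hσ.smooth.contDiffAt ((isOpen_base hf).mem_nhds hb)).differentiableAt (by simp)

lemma contDiffOn_sCoord {f : ℝ → ℝ} (hf : IsAdmissible f) {σ : ℝ × ℝ → E}
    (hσ : IsLagrangianSection f σ) : ContDiffOn ℝ ∞ (sCoord f σ) B0 := by
  have h1 : ContDiff ℝ ∞ (fun p : E => p.1.im) := Complex.imCLM.contDiff.comp contDiff_fst
  exact ((h1.contDiffOn.log fun p hp => ne_of_gt hp.1).sub
    ((h1.comp_contDiffOn (hσ.contDiffOn_comp_H hf)).log
      fun p hp => ne_of_gt (hσ.mem _ (H_mem_base hp)).1)).div_const 2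

lemma contMDiffOn_thetaCoord {f : ℝ → ℝ} (hf : IsAdmissible f) {σ : ℝ × ℝ → E}
    (hσ : IsLagrangianSection f σ) : ContMDiffOn 𝓘(ℝ, E) (𝓡 1) ∞ (thetaCoord f σ) B0 :=
  contMDiffOn_circleExp_arg isOpen_B0
    (by
      simp only [div_eq_mul_inv]
      exact contDiff_snd.contDiffOn.mul
        ((contDiff_snd.comp_contDiffOn (hσ.contDiffOn_comp_H hf)).inv
          fun _ hp => (hσ.mem _ (H_mem_base hp)).2))
    fun _ hp => div_ne_zero hp.2 (hσ.mem _ (H_mem_base hp)).2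

lemma H_act_section {f : ℝ → ℝ} {σ : ℝ × ℝ → E} (hσ : IsLagrangianSection f σ) {b : ℝ × ℝ}
    (hb : b ∈ base f) (t : ℝ) (c : Circle) : H f (act t c (σ b)) = b := by
  rw [H_act, hσ.section_eq b hb]

lemma sCoord_act {f : ℝ → ℝ} {σ : ℝ × ℝ → E} {p : E} (hp : p ∈ B0)
    (t : ℝ) (c : Circle) : sCoord f σ (act t c p) = t + sCoord f σ p := by
  rw [sCoord, H_act, act_fst_im, Real.log_mul (Real.exp_pos _).ne' (ne_of_gt hp.1), Real.log_exp,
    sCoord]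
  ring

lemma thetaCoord_act {f : ℝ → ℝ} {σ : ℝ × ℝ → E} (hσ : IsLagrangianSection f σ) {p : E}
    (hp : p ∈ B0) (t : ℝ) (c : Circle) : thetaCoord f σ (act t c p) = c * thetaCoord f σ p := by
  have hq := (hσ.mem _ (H_mem_base (f := f) hp)).2
  rw [thetaCoord, H_act, thetaCoord,
    circleExp_arg_eq_mul (div_ne_zero (act_mem hp t c).2 hq) (div_ne_zero hp.2 hq),
    div_div_div_cancel_right₀ hq, act, mul_div_cancel_right₀ _ hp.2,
    circleExp_arg_ofReal_mul (Real.exp_pos _)]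

lemma sCoord_section {f : ℝ → ℝ} {σ : ℝ × ℝ → E} (hσ : IsLagrangianSection f σ) {b : ℝ × ℝ}
    (hb : b ∈ base f) : sCoord f σ (σ b) = 0 := by
  rw [sCoord, hσ.section_eq b hb, sub_self, zero_div]

lemma thetaCoord_section {f : ℝ → ℝ} {σ : ℝ × ℝ → E} (hσ : IsLagrangianSection f σ) {b : ℝ × ℝ}
    (hb : b ∈ base f) : thetaCoord f σ (σ b) = 1 := by
  rw [thetaCoord, hσ.section_eq b hb, div_self (hσ.mem b hb).2, Complex.arg_one, Circle.exp_zero]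

lemma act_coords {f : ℝ → ℝ} (hf : IsAdmissible f) {σ : ℝ × ℝ → E} (hσ : IsLagrangianSection f σ)
    {p : E} (hp : p ∈ B0) : act (sCoord f σ p) (thetaCoord f σ p) (σ (H f p)) = p :=
  act_eq_of_H_eq hf hp (hσ.mem _ (H_mem_base hp)) (hσ.section_eq _ (H_mem_base hp)).symm

lemma isAngleCoordinates {f : ℝ → ℝ} (hf : IsAdmissible f) {σ : ℝ × ℝ → E}
    (hσ : IsLagrangianSection f σ) :
    IsAngleCoordinates f σ (thetaCoord f σ) (sCoord f σ) where
  smooth_theta := hσ.contMDiffOn_thetaCoord hf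
  smooth_s := hσ.contDiffOn_sCoord hf
  bijOn_fibre b hb := by
    refine ⟨mapsTo_univ _ _, ?_, ?_⟩
    · rintro p ⟨hp, hpb⟩ q ⟨hq, hqb⟩ h
      obtain ⟨h1, h2⟩ := Prod.ext_iff.1 h
      simp only at h1 h2
      rw [← hσ.act_coords hf hp, ← hσ.act_coords hf hq, h1, h2, hpb, hqb]
    · rintro ⟨t, c⟩ -
      refine ⟨act t c (σ b), ⟨act_mem (hσ.mem b hb) _ _, hσ.H_act_section hb _ _⟩, ?_⟩
      simp only [sCoord_act (hσ.mem b hb), hσ.thetaCoord_act (hσ.mem b hb), hσ.sCoord_section hb,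
        hσ.thetaCoord_section hb, mul_one, add_zero]
  flow_H1 γ hγ t := by
    rw [hγ.eq_act_H1 hf t, hσ.thetaCoord_act (hγ 0).1, sCoord_act (hγ 0).1, zero_add]
    exact ⟨rfl, rfl⟩
  flow_H2 γ hγ t := by
    rw [hγ.eq_act_H2 hf t, hσ.thetaCoord_act (hγ 0).1, sCoord_act (hγ 0).1, one_mul]
    exact ⟨rfl, rfl⟩
  theta_origin _ := hσ.thetaCoord_section
  s_origin _ := hσ.sCoord_section

/-- Angle coordinates with origin on a given section are unique. -/
lemma eq_coords {f : ℝ → ℝ} (hf : IsAdmissible f) {σ : ℝ × ℝ → E} (hσ : IsLagrangianSection f σ)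
    {θ : E → Circle} {s : E → ℝ} (h : IsAngleCoordinates f σ θ s) {p : E} (hp : p ∈ B0) :
    θ p = thetaCoord f σ p ∧ s p = sCoord f σ p := by
  have hb := H_mem_base (f := f) hp
  have hq := hσ.mem _ hb
  -- The point `p` is reached from the section by flowing along `H2` for time `sCoord` and then
  -- along `H1` for a time representing `thetaCoord`; the axioms prescribe both coordinates along
  -- this path.
  obtain ⟨h1, h2⟩ := h.flow_H2 _ (isHamiltonianTrajectory_H2 hf hq) (sCoord f σ p)
  obtain ⟨h3, h4⟩ := h.flow_H1 _ (isHamiltonianTrajectory_H1 hf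
    (act_mem hq (sCoord f σ p) 1)) (Complex.arg (thetaCoord f σ p))
  simp only [act_zero_act, act_zero_one, Circle.exp_arg, Circle.exp_zero, hσ.act_coords hf hp,
    h.theta_origin _ hb, h.s_origin _ hb] at h1 h2 h3 h4
  exact ⟨by rw [h3, h1, mul_one], by rw [h4, h2, add_zero]⟩

lemma fderiv_sCoord {f : ℝ → ℝ} (hf : IsAdmissible f) {σ : ℝ × ℝ → E} (hσ : IsLagrangianSection f σ)
    {p : E} (hp : p ∈ B0) (a : E) : fderiv ℝ (sCoord f σ) p a =
      dHalfLog p a - dHalfLog (σ (H f p)) (fderiv ℝ σ (H f p) (fderiv ℝ (H f) p a)) := by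
  have hb := H_mem_base (f := f) hp
  have h1 := (hσ.differentiableAt hf hb).hasFDerivAt.comp p (hf.differentiableAt_H hp).hasFDerivAt
  have hy := (Complex.imCLM.comp (ContinuousLinearMap.fst ℝ ℂ ℂ)).hasFDerivAt (x := p)
  have h2 := (Complex.imCLM.comp (ContinuousLinearMap.fst ℝ ℂ ℂ)).hasFDerivAt.comp p h1
  have h3 := ((hy.log (ne_of_gt hp.1)).sub (h2.log (ne_of_gt (hσ.mem _ hb).1))).mul_const
    (1 / 2 : ℝ)
  have h4 : HasFDerivAt (sCoord f σ) _ p :=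
    h3.congr_of_eventuallyEq (Eventually.of_forall fun q => by simp [sCoord]; ring)
  rw [h4.fderiv]
  simp [dHalfLog]
  ring

lemma angleDiff_thetaCoord {f : ℝ → ℝ} (hf : IsAdmissible f) {σ : ℝ × ℝ → E}
    (hσ : IsLagrangianSection f σ) {p : E} (hp : p ∈ B0) (a : E) :
    angleDiff (thetaCoord f σ) p a =
      dArg p a - dArg (σ (H f p)) (fderiv ℝ σ (H f p) (fderiv ℝ (H f) p a)) := by
  have hb := H_mem_base (f := f) hp
  have hw := (hσ.mem _ hb).2
  have h1 := (hσ.differentiableAt hf hb).hasFDerivAt.comp p (hf.differentiableAt_H hp).hasFDerivAt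
  have hn := (ContinuousLinearMap.snd ℝ ℂ ℂ).hasFDerivAt (x := p)
  have h2 := (ContinuousLinearMap.snd ℝ ℂ ℂ).hasFDerivAt.comp p h1
  have h3 := hn.mul (((hasDerivAt_inv hw).hasFDerivAt.restrictScalars ℝ).comp p h2)
  have h4 : HasFDerivAt (fun q => q.2 / (σ (H f q)).2) _ p :=
    h3.congr_of_eventuallyEq (Eventually.of_forall fun q => by simp [div_eq_mul_inv])
  have h5 := fderiv_coe_circleExp_arg h4 (div_ne_zero hp.2 hw) a
  rw [angleDiff]
  simp only [thetaCoord]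
  rw [h5, ← mul_assoc, ← Complex.normSq_eq_conj_mul_self, Circle.normSq_coe, dArg, dArg,
    ← Complex.sub_im]
  simp only [Complex.ofReal_one, one_mul, Complex.mul_I_im, Complex.ofReal_re]
  congr 1
  simp
  have := hp.2
  field_simp
  ring

/-! ### The Darboux frame. -/

/-- The decomposition at `p` minus its pullback along σ ∘ H, which vanishes by the Lagrangian
condition: the differences of `dArg` and `dHalfLog` are dθ and ds, and the term from the base
cancels. -/
lemma omega_eq {f : ℝ → ℝ} (hf : IsAdmissible f) {σ : ℝ × ℝ → E} (hσ : IsLagrangianSection f σ)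
    {p : E} (hp : p ∈ B0) (v w : E) :
    omega f p v w = wedge (angleDiff (thetaCoord f σ) p) (fderiv ℝ (H1 f) p) v w +
      wedge (fderiv ℝ (sCoord f σ) p) (fderiv ℝ (H2 f) p) v w := by
  have hb := H_mem_base (f := f) hp
  have hq := hσ.mem _ hb
  have h := hσ.lagrangian _ hb (fderiv ℝ (H f) p v) (fderiv ℝ (H f) p w)
  have hN : f (fibreNormSq (σ (H f p))) = f (fibreNormSq p) := by
    have : 2 / 3 * f (fibreNormSq (σ (H f p))) = 2 / 3 * f (fibreNormSq p) :=
      congrArg Prod.fst (hσ.section_eq _ hb)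
    linarith
  -- Infinitesimal form of H ∘ σ ∘ H = H.
  have hD : ∀ a, fderiv ℝ (H1 f) (σ (H f p)) (fderiv ℝ σ (H f p) (fderiv ℝ (H f) p a)) =
      fderiv ℝ (H1 f) p a ∧
      fderiv ℝ (H2 f) (σ (H f p)) (fderiv ℝ σ (H f p) (fderiv ℝ (H f) p a)) =
      fderiv ℝ (H2 f) p a := fun a => by
    have h1 := fderiv_H_section hf hb (hσ.differentiableAt hf hb) hq hσ.section_eq
      (fderiv ℝ (H f) p a)
    rw [hf.fderiv_H hq] at h1
    nth_rw 3 [hf.fderiv_H hp] at h1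
    exact Prod.ext_iff.1 h1
  rw [omega_eq_wedge hf hq] at h
  rw [omega_eq_wedge hf hp]
  simp only [wedge, hD, hN, hσ.fderiv_sCoord hf hp, hσ.angleDiff_thetaCoord hf hp] at h ⊢
  linear_combination h

/-- This map is the inverse of the Darboux chart. -/
lemma contMDiffOn_act {f : ℝ → ℝ} {σ : ℝ × ℝ → E} (hσ : IsLagrangianSection f σ) :
    ContMDiffOn ((𝓡 1).prod 𝓘(ℝ, ℝ × ℝ × ℝ)) 𝓘(ℝ, E) ∞
      (fun q : Circle × (ℝ × ℝ × ℝ) => act q.2.2.1 q.1 (σ (q.2.1, q.2.2.2)))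
      {q | (q.2.1, q.2.2.2) ∈ base f} := by
  have hc : ContMDiff (𝓡 1) 𝓘(ℝ, ℂ) ∞ (fun c : Circle => (c : ℂ)) := by
    have := Fact.mk (Complex.finrank_real_complex)
    exact contMDiff_coe_sphere
  have hA : ContDiff ℝ ∞ (fun x : ℂ × ℝ × E =>
      (((Real.exp (2 * x.2.1) : ℂ) * x.2.2.1, (Real.exp (-3 * x.2.1) : ℂ) * x.1 * x.2.2.2) : E)) := by
    have h1 : ∀ k : ℝ, ContDiff ℝ ∞ (fun x : ℂ × ℝ × E => (Real.exp (k * x.2.1) : ℂ)) := fun k =>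
      Complex.ofRealCLM.contDiff.comp (Real.contDiff_exp.comp (by fun_prop))
    exact ((h1 2).mul (by fun_prop)).prodMk (((h1 (-3)).mul (by fun_prop)).mul (by fun_prop))
  have h2 : ContMDiff ((𝓡 1).prod 𝓘(ℝ, ℝ × ℝ × ℝ)) 𝓘(ℝ, ℝ × ℝ × ℝ) ∞
    (fun q : Circle × (ℝ × ℝ × ℝ) => q.2) := contMDiff_snd
  have ht : ContMDiff ((𝓡 1).prod 𝓘(ℝ, ℝ × ℝ × ℝ)) 𝓘(ℝ, ℝ) ∞
      (fun q : Circle × (ℝ × ℝ × ℝ) => q.2.2.1) := by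
    have : ContDiff ℝ ∞ (fun x : ℝ × ℝ × ℝ => x.2.1) := by fun_prop
    exact this.contMDiff.comp h2
  have hb : ContMDiff ((𝓡 1).prod 𝓘(ℝ, ℝ × ℝ × ℝ)) 𝓘(ℝ, ℝ × ℝ) ∞
      (fun q : Circle × (ℝ × ℝ × ℝ) => (q.2.1, q.2.2.2)) := by
    have : ContDiff ℝ ∞ (fun x : ℝ × ℝ × ℝ => (x.1, x.2.2)) := by fun_prop
    exact this.contMDiff.comp h2
  have hσb : ContMDiffOn ((𝓡 1).prod 𝓘(ℝ, ℝ × ℝ × ℝ)) 𝓘(ℝ, E) ∞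
      (fun q : Circle × (ℝ × ℝ × ℝ) => σ (q.2.1, q.2.2.2)) {q | (q.2.1, q.2.2.2) ∈ base f} :=
    hσ.smooth.contMDiffOn.comp hb.contMDiffOn fun _ hq => hq
  exact hA.contMDiff.comp_contMDiffOn
    ((hc.comp contMDiff_fst).contMDiffOn.prodMk_space (ht.contMDiffOn.prodMk_space hσb))

lemma isGlobalDarbouxFrame {f : ℝ → ℝ} (hf : IsAdmissible f) {σ : ℝ × ℝ → E}
    (hσ : IsLagrangianSection f σ) {θ : E → Circle} {s : E → ℝ}
    (h : IsAngleCoordinates f σ θ s) : IsGlobalDarbouxFrame f θ s := by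
  have hθ : ∀ p ∈ B0, θ p = thetaCoord f σ p := fun p hp => (hσ.eq_coords hf h hp).1
  have hs : ∀ p ∈ B0, s p = sCoord f σ p := fun p hp => (hσ.eq_coords hf h hp).2
  refine ⟨⟨{
    toFun := fun p => (θ p, H1 f p, s p, H2 f p)
    invFun := fun q => act q.2.2.1 q.1 (σ (q.2.1, q.2.2.2))
    source := B0
    target := {q | (q.2.1, q.2.2.2) ∈ base f}
    map_source' := fun p hp => H_mem_base hp
    map_target' := fun q hq => act_mem (hσ.mem _ hq) _ _
    left_inv' := fun p hp => ?_
    right_inv' := fun q hq => ?_ }, rfl, rfl, fun _ _ => rfl, ?_, hσ.contMDiffOn_act⟩, ?_⟩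
  · simp only [hθ p hp, hs p hp]
    exact hσ.act_coords hf hp
  · have hq' := hσ.mem _ hq
    have h1 := hσ.H_act_section hq q.2.2.1 q.1
    obtain ⟨h2, h3⟩ := Prod.ext_iff.1 h1
    simp only [H] at h2 h3
    simp only [hθ _ (act_mem hq' _ _), hs _ (act_mem hq' _ _), sCoord_act hq',
      hσ.thetaCoord_act hq', hσ.sCoord_section hq, hσ.thetaCoord_section hq, mul_one, add_zero,
      h2, h3]
  · exact h.smooth_theta.prodMk
      (hf.contDiffOn_H1.prodMk (h.smooth_s.prodMk hf.contDiffOn_H2)).contMDiffOn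
  · intro p hp v w
    have h1 : s =ᶠ[𝓝 p] sCoord f σ := by
      filter_upwards [isOpen_B0.mem_nhds hp] with q hq using hs q hq
    have h2 : (fun q => (θ q : ℂ)) =ᶠ[𝓝 p] fun q => (thetaCoord f σ q : ℂ) := by
      filter_upwards [isOpen_B0.mem_nhds hp] with q hq using by rw [hθ q hq]
    have h3 : angleDiff θ p = angleDiff (thetaCoord f σ) p := by
      ext a
      rw [angleDiff, angleDiff, h2.fderiv_eq, hθ p hp]
    rw [hσ.omega_eq hf hp, h1.fderiv_eq, h3]

end IsLagrangianSection

/-! ### Existence of a Lagrangian section. -/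

lemma IsAdmissible.exists_contDiffOn_inverse {f : ℝ → ℝ} (hf : IsAdmissible f) :
    ∃ g : ℝ → ℝ, ContDiffOn ℝ ∞ g (Iio 0) ∧ ∀ c < 0, 0 < g c ∧ f (g c) = c := by
  choose! g hg using fun c : ℝ => hf.exists_pos_eq (c := c)
  refine ⟨g, fun c hc => ContDiffAt.contDiffWithinAt ?_, hg⟩
  obtain ⟨h0, hfg⟩ := hg c hc
  have hd := hf.contDiffAt h0
  have hne : derivWithin f (Ici 0) (g c) ≠ 0 := (hf.deriv_neg _ h0.le).ne
  have hd' : HasFDerivAt f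
      (ContinuousLinearEquiv.unitsEquivAut ℝ (Units.mk0 _ hne) : ℝ →L[ℝ] ℝ) (g c) := by
    refine (hf.hasDerivAt h0).hasFDerivAt.congr_fderiv ?_
    ext
    simp
  have hn : (∞ : WithTop ℕ∞) ≠ 0 := by simp
  have h1 := hd.to_localInverse hd' hn
  rw [hfg] at h1
  refine h1.congr_of_eventuallyEq ?_
  have h2 := (hd.hasStrictFDerivAt' hd' hn).eventually_right_inverse
  have h4 := hd.localInverse_apply_image hd' hn
  rw [hfg] at h2 h4
  -- Near `c` the local inverse stays positive, so injectivity of `f` on the half-line identifies it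
  -- with the globally chosen `g`, which thereby inherits its smoothness.
  have h3 : ∀ᶠ x in 𝓝 c, 0 < hd.localInverse hd' hn x :=
     h1.continuousAt.eventually (lt_mem_nhds (by rwa [h4]))
  filter_upwards [h2, h3, Iio_mem_nhds hc] with x hx2 hx3 hx
  exact hf.strictAntiOn.injOn (hg x hx).1.le hx3.le ((hg x hx).2.trans hx2.symm)

lemma exists_isLagrangianSection {f : ℝ → ℝ} (hf : IsAdmissible f) :
    ∃ σ : ℝ × ℝ → E, IsLagrangianSection f σ := by
  obtain ⟨g, hg, hgf⟩ := hf.exists_contDiffOn_inverse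
  set r : ℝ × ℝ → ℝ := fun b => √(g (3 / 2 * b.1) / (1 - 3 / 2 * b.1) ^ 3) with hr
  set L : ℝ × ℝ × ℝ → E := fun x => (⟨x.1, x.2.1⟩, (x.2.2 : ℝ)) with hL
  set σ : ℝ × ℝ → E := fun b => L (b.2 / 2, 1 - 3 / 2 * b.1, r b) with hσ
  have hb0 : ∀ b ∈ base f, b.1 < 0 := fun b hb => by rwa [base_eq hf] at hb
  have hgb : ∀ b ∈ base f, 0 < g (3 / 2 * b.1) ∧ f (g (3 / 2 * b.1)) = 3 / 2 * b.1 := fun b hb =>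
    hgf _ (by linarith [hb0 b hb])
  have hsec : ∀ b ∈ base f, H f (σ b) = b := fun b hb =>
    H_mk (hb0 b hb) (hgb b hb).1 (hgb b hb).2
  have hmem : ∀ b ∈ base f, σ b ∈ B0 := fun b hb => mk_mem_B0 (hb0 b hb) (hgb b hb).1
  have hrs : ContDiffOn ℝ ∞ r (base f) := by
    refine ContDiffOn.sqrt (ContDiffOn.div ?_ (by fun_prop) ?_) ?_
    · exact hg.comp (by fun_prop) fun b hb => by
        have := hb0 b hb
        simp only [mem_Iio]
        linarith
    · intro b hb
      have := hb0 b hb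
      exact pow_ne_zero 3 (by linarith)
    · intro b hb
      have := hb0 b hb
      exact (div_pos (hgb b hb).1 (pow_pos (by linarith) 3)).ne'
  -- Bundling `L` as a continuous linear map reduces the smoothness and the derivative of `σ` to
  -- those of its three real components.
  have hLs : ∃ L' : ℝ × ℝ × ℝ →L[ℝ] E, ∀ x, L' x = L x := by
    refine ⟨((Complex.equivRealProdCLM.symm : ℝ × ℝ →L[ℝ] ℂ).comp
      ((ContinuousLinearMap.fst ℝ ℝ (ℝ × ℝ)).prod
        ((ContinuousLinearMap.fst ℝ ℝ ℝ).comp (ContinuousLinearMap.snd ℝ ℝ (ℝ × ℝ))))).prod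
      (Complex.ofRealCLM.comp
        ((ContinuousLinearMap.snd ℝ ℝ ℝ).comp (ContinuousLinearMap.snd ℝ ℝ (ℝ × ℝ)))), fun x => ?_⟩
    refine Prod.ext (Complex.ext ?_ ?_) ?_ <;> simp [hL]
  obtain ⟨L', hL'⟩ := hLs
  have hσL : σ = fun b => L' (b.2 / 2, 1 - 3 / 2 * b.1, r b) := by
    funext b
    rw [hL', hσ]
  have hσs : ContDiffOn ℝ ∞ σ (base f) := by
    rw [hσL]
    exact L'.contDiff.comp_contDiffOn (ContDiffOn.prodMk (by fun_prop)
      (ContDiffOn.prodMk (by fun_prop) hrs))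
  refine ⟨σ, hσs, hmem, hsec, fun b hb v w => ?_⟩
  have hbn := (isOpen_base hf).mem_nhds hb
  have hrd := ((hrs.contDiffAt hbn).differentiableAt (by simp)).hasFDerivAt
  have hσd := ((hσs.contDiffAt hbn).differentiableAt (by simp))
  have hD : ∀ v : ℝ × ℝ, fderiv ℝ σ b v = L (v.2 / 2, -(3 / 2 * v.1), fderiv ℝ r b v) := by
    intro v
    have h1 : HasFDerivAt (fun b : ℝ × ℝ => b.2 / 2)
      ((1 / 2 : ℝ) • ContinuousLinearMap.snd ℝ ℝ ℝ) b := by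
      refine ((ContinuousLinearMap.snd ℝ ℝ ℝ).hasFDerivAt.const_smul (1 / 2 : ℝ)).congr_of_eventuallyEq
        (Eventually.of_forall fun x => ?_)
      simp
      ring
    have h2 : HasFDerivAt (fun b : ℝ × ℝ => 1 - 3 / 2 * b.1)
      (-((3 / 2 : ℝ) • ContinuousLinearMap.fst ℝ ℝ ℝ)) b :=
      ((ContinuousLinearMap.fst ℝ ℝ ℝ).hasFDerivAt.const_mul (3 / 2 : ℝ)).const_sub 1
    have h3 := L'.hasFDerivAt.comp b (h1.prodMk (h2.prodMk hrd))
    have h4 : HasFDerivAt σ _ b := h3.congr_of_eventuallyEq (Eventually.of_forall (congrFun hσL))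
    rw [h4.fderiv, ← hL']
    simp
    ring_nf
  -- This relation links the derivative of `r` to f', so neither has to be computed from the inverse
  -- function `g`.
  have hH1 : ∀ v : ℝ × ℝ, fderiv ℝ (H1 f) (σ b) (fderiv ℝ σ b v) = v.1 := fun v => by
    have := fderiv_H_section hf hb hσd (hmem b hb) hsec v
    rw [hf.fderiv_H (hmem b hb)] at this
    exact congrArg Prod.fst this
  have hfN : f (fibreNormSq (σ b)) = 3 / 2 * b.1 := by
    have := congrArg Prod.fst (hsec b hb)
    simp only [H, H1] at this
    linarith
  have hy : 1 - 3 / 2 * b.1 ≠ 0 := by linarith [hb0 b hb]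
  have hv := hH1 v
  have hw := hH1 w
  rw [hf.fderiv_H1 (hmem b hb), hD] at hv hw
  simp only [omega, wedge, dx, dy, du, dv, ← fibreNormSq_eq, hfN, hD]
  generalize derivWithin f (Ici 0) (fibreNormSq (σ b)) = F' at *
  simp only [hσ, hL, Complex.ofReal_re, Complex.ofReal_im] at hv hw ⊢
  generalize r b = u at *
  generalize fderiv ℝ r b v = v' at *
  generalize fderiv ℝ r b w = w' at *
  -- On the section f = 1 - y, so the coefficient -1 + f becomes -y and `b.1` can be eliminated.
  have hb1 : 3 / 2 * b.1 = 1 - (1 - 3 / 2 * b.1) := by ring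
  nth_rw 1 [hb1]
  generalize 1 - 3 / 2 * b.1 = y at *
  field_simp
  linear_combination (-9 * y * v.2) * hw + (9 * y * w.2) * hv

end ConvexTorus

theorem theoremA (f : ℝ → ℝ) (hf : ConvexTorus.IsAdmissible f) :
    -- the base of the fibration is an open half-plane
    ConvexTorus.base f = {b : ℝ × ℝ | b.1 < 0} ∧
    -- the Hamiltonian vector fields of both integrals of motion are complete
    (∀ p ∈ ConvexTorus.B0,
      (∃ γ : ℝ → ConvexTorus.E, γ 0 = p ∧
        ConvexTorus.IsHamiltonianTrajectory f (ConvexTorus.H1 f) γ) ∧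
      (∃ γ : ℝ → ConvexTorus.E, γ 0 = p ∧
        ConvexTorus.IsHamiltonianTrajectory f (ConvexTorus.H2 f) γ)) ∧
    -- there is a global Lagrangian section
    (∃ σ : ℝ × ℝ → ConvexTorus.E, ConvexTorus.IsLagrangianSection f σ) ∧
    -- angle coordinates measured from a global Lagrangian section exist, and together with the
    -- integrals of motion they form a global Darboux frame
    (∀ σ : ℝ × ℝ → ConvexTorus.E, ConvexTorus.IsLagrangianSection f σ →
      (∃ (θ : ConvexTorus.E → Circle) (s : ConvexTorus.E → ℝ),
        ConvexTorus.IsAngleCoordinates f σ θ s) ∧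
      (∀ (θ : ConvexTorus.E → Circle) (s : ConvexTorus.E → ℝ),
        ConvexTorus.IsAngleCoordinates f σ θ s → ConvexTorus.IsGlobalDarbouxFrame f θ s)) := by
  refine ⟨ConvexTorus.base_eq hf, fun p hp => ⟨?_, ?_⟩, ConvexTorus.exists_isLagrangianSection hf,
    fun σ hσ => ⟨⟨_, _, hσ.isAngleCoordinates hf⟩, fun θ s h => hσ.isGlobalDarbouxFrame hf h⟩⟩
  · exact ⟨_, by simp [ConvexTorus.act_zero_one], ConvexTorus.isHamiltonianTrajectory_H1 hf hp⟩
  · exact ⟨_, by simp [ConvexTorus.act_zero_one], ConvexTorus.isHamiltonianTrajectory_H2 hf hp⟩
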